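/- Let $\mathbb K\in\{\mathbb R,\mathbb C\}$. For $N\in\mathbb N=\{1,2,\dots\}$, let $L_1^{N}$ and $L_\infty^{N}$ be the spaces of functions on $\{1,\dots,N\}$ with norms $\|g\|_{L_1^N}=\frac1N\sum_{j=1}^N\|g(j)\|$ and $\|g\|_{L_\infty^N}=\max_{1\le j\le N}\|g(j)\|$. For $N_1,N_2\in\mathbb N$ let $L_1^{N_1}(L_\infty^{N_2})$ and $L_\infty^{N_1}(L_1^{N_2})$ be the spaces of all $f:\{1,\dots,N_1\}\times\{1,\dots,N_2\}\to\mathbb K$ with norms $\frac1{N_1}\sum_{i}\max_j|f(i,j)|$ and $\max_i\frac1{N_2}\sum_j|f(i,j)|$, respectively. Consider approximating the embedding $J^{N_1,N_2}:L_1^{N_1}(L_\infty^{N_2})\to L_\infty^{N_1}(L_1^{N_2})$, $J^{N_1,N_2}f=f$, on the closed unit ball $B$ of $L_1^{N_1}(L_\infty^{N_2})$, using values $f(i,j)$ as information. A deterministic algorithm successively queries entries $f(i,j)$, where each query, the decision whether to stop, and the output may depend arbitrarily on the values obtained so far; its cardinality $\mathrm{card}(A,f)\in\{0,1,\dots,\infty\}$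 is the number of values obtained when it first stops ($\infty$ if it never stops), and its output $A(f)$ is computed from these values (a fixed element if $\mathrm{card}(A,f)\in\{0,\infty\}$). It is non-adaptive if all queries and all stopping decisions are independent of the values obtained. A randomized algorithm is a family $(A_\omega)_{\omega\in\Omega}$ of deterministic algorithms over a probability space; it is non-adaptive if every $A_\omega$ is. For $n\in\mathbb N$ let $e_n^{\rm ran}(J^{N_1,N_2})$ be the infimum of $$\sup_{f\in B}\mathbb E\,\|f-A_\omega(f)\|_{L_\infty^{N_1}(L_1^{N_2})}$$ over all randomized algorithms such that, for every $f\in B$, the map $\omega\mapsto\mathrm{card}(A_\omega,f)$ is measurable with $\mathbb E\,\mathrm{card}(A_\omega,f)\le n$, and $\omega\mapsto A_\omega(f)$ is Borel measurable and almost surely separably valued; let $e_n^{\rm ran-non}(J^{N_1,N_2})$ be the infimum over the non-adaptive ones among them. Then there are constants $c_0\in(0,1)$ and $c_1,c_2>0$ such that for every $n\in\mathbb N$, with $$N_1=N_2=\lfloor c_0^{-1/2}n^{1/2}\rfloor+1,$$ one has $0<e_n^{\rm ran}(J^{N_1,N_2})<\infty$, $e_n^{\rm ran-non}(J^{N_1,N_2})<\infty$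 and $$c_1\,n^{1/2}\,(\log_2(n+1))^{-1}\ \le\ \frac{e_n^{\rm ran-non}(J^{N_1,N_2})}{e_n^{\rm ran}(J^{N_1,N_2})}\ \le\ c_2\,n^{1/2}.$$ -/

import Mathlib

open scoped ENNReal
open MeasureTheory

universe u v

namespace IBC

noncomputable section

/-! ### The spaces `L_p^N(E)` -/

/-- The normalized `p`-norm of a finite sequence: `(N⁻¹ ∑ ‖f i‖ ^ p) ^ (1 / p)` for `p < ∞`, and
the maximum of the `‖f i‖` for `p = ∞`. -/
def meanNorm {E : Type*} [NormedAddCommGroup E] (p : ℝ≥0∞) {N : ℕ} (f : Fin N → E) : ℝ :=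
  if p = ∞ then ⨆ i, ‖f i‖
  else ((1 / (N : ℝ)) * ∑ i, ‖f i‖ ^ p.toReal) ^ (1 / p.toReal)

/-- The space `L_p^N(E)` of all functions from an `N`-element set to `E`, normed by `meanNorm p`. -/
def LSpace (p : ℝ≥0∞) (N : ℕ) (E : Type*) : Type _ := Fin N → E

instance {p : ℝ≥0∞} {N : ℕ} {E : Type*} [AddCommGroup E] : AddCommGroup (LSpace p N E) :=
  inferInstanceAs (AddCommGroup (Fin N → E))

theorem meanNorm_add_le {E : Type*} [NormedAddCommGroup E] {p : ℝ≥0∞} (hp : 1 ≤ p) {N : ℕ}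
    (f g : Fin N → E) : meanNorm p (f + g) ≤ meanNorm p f + meanNorm p g := by
  unfold meanNorm
  split_ifs with h
  · rcases isEmpty_or_nonempty (Fin N) with hN | hN
    · simp [Real.iSup_of_isEmpty]
    · refine ciSup_le fun i => (norm_add_le _ _).trans (add_le_add ?_ ?_)
      · exact le_ciSup (f := fun i => ‖f i‖) (Set.finite_range _).bddAbove i
      · exact le_ciSup (f := fun i => ‖g i‖) (Set.finite_range _).bddAbove i
  · have hp1 : 1 ≤ p.toReal := by
      simpa using (ENNReal.toReal_le_toReal ENNReal.one_ne_top h).2 hp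
    have hN : (0 : ℝ) ≤ 1 / (N : ℝ) := by positivity
    have hs : ∀ k : Fin N → E, 0 ≤ ∑ i, ‖k i‖ ^ p.toReal := fun k => by positivity
    rw [Real.mul_rpow hN (hs _), Real.mul_rpow hN (hs _), Real.mul_rpow hN (hs _), ← mul_add]
    refine mul_le_mul_of_nonneg_left ?_ (by positivity)
    refine le_trans ?_ (Real.Lp_add_le_of_nonneg (f := fun i => ‖f i‖) (g := fun i => ‖g i‖)
      Finset.univ hp1 (fun i _ => norm_nonneg _) (fun i _ => norm_nonneg _))
    gcongr with i
    exact norm_add_le _ _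

theorem eq_zero_of_meanNorm_eq_zero {E : Type*} [NormedAddCommGroup E] {p : ℝ≥0∞} (hp : 1 ≤ p)
    {N : ℕ} (f : Fin N → E) (hf : meanNorm p f = 0) : f = 0 := by
  funext i
  have hN : 0 < N := i.pos
  unfold meanNorm at hf
  split_ifs at hf with h
  · have := le_ciSup (f := fun i => ‖f i‖) (Set.finite_range _).bddAbove i
    exact norm_le_zero_iff.1 (by simpa [hf] using this)
  · have hp0 : 0 < p.toReal :=
      ENNReal.toReal_pos (zero_lt_one.trans_le hp).ne' h
    have hs : 0 ≤ ∑ i, ‖f i‖ ^ p.toReal := by positivity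
    have h1 := (Real.rpow_eq_zero (by positivity) (by positivity)).1 hf
    have h2 : ∑ i, ‖f i‖ ^ p.toReal = 0 := by
      rcases mul_eq_zero.1 h1 with h3 | h3
      · have : (0 : ℝ) < 1 / (N : ℝ) := by positivity
        exact absurd h3 this.ne'
      · exact h3
    have h4 := (Finset.sum_eq_zero_iff_of_nonneg (fun i _ => by positivity)).1 h2 i
      (Finset.mem_univ i)
    exact norm_eq_zero.1 ((Real.rpow_eq_zero (norm_nonneg _) hp0.ne').1 h4)

theorem meanNorm_zero {E : Type*} [NormedAddCommGroup E] {p : ℝ≥0∞} (hp : 1 ≤ p) {N : ℕ} :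
    meanNorm p (0 : Fin N → E) = 0 := by
  unfold meanNorm
  split_ifs with h
  · simp
  · have hp0 : 0 < p.toReal := ENNReal.toReal_pos (zero_lt_one.trans_le hp).ne' h
    simp [Real.zero_rpow hp0.ne', Real.zero_rpow (inv_pos.2 hp0).ne']

instance {p : ℝ≥0∞} [hp : Fact (1 ≤ p)] {N : ℕ} {E : Type*} [NormedAddCommGroup E] :
    NormedAddCommGroup (LSpace p N E) :=
  AddGroupNorm.toNormedAddCommGroup
    { toFun := fun f => meanNorm p f
      map_zero' := meanNorm_zero hp.out
      add_le' := fun f g => meanNorm_add_le hp.out f g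
      neg' := fun f => by
        have : ∀ i, ‖(-f) i‖ = ‖f i‖ := fun i => norm_neg (f i)
        simp only [meanNorm, this]
      eq_zero_of_map_eq_zero' := fun f hf => eq_zero_of_meanNorm_eq_zero hp.out f hf }

theorem LSpace.norm_def {p : ℝ≥0∞} [Fact (1 ≤ p)] {N : ℕ} {E : Type*} [NormedAddCommGroup E]
    (f : LSpace p N E) : ‖f‖ = meanNorm p f := rfl

/-! ### Numerical problems and algorithms -/

/-- A numerical problem `(F, G, S, K, Λ)`: inputs `F`, solution operator `S : F → G`, and a
nonempty set `Λ` of information functionals `F → K`. -/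
structure Problem (F G K : Type*) where
  /-- the solution operator `S` -/
  sol : F → G
  /-- the class `Λ` of information functionals -/
  info : Set (F → K)
  info_nonempty : info.Nonempty

/-- A deterministic (adaptive) algorithm. For `i = 0` the domain `K ^ 0` is a single point, so
`query 0`, `halt 0`, `output 0` are the constants `L₁ ∈ Λ`, `τ₀ ∈ {0, 1}`, `φ₀ ∈ G`. -/
structure DetAlgorithm {F G K : Type*} (P : Problem F G K) where
  /-- `query i` is `L_{i+1} : K ^ i → Λ` -/
  query : (i : ℕ) → (Fin i → K) → P.info
  /-- `halt i` is `τ_i : K ^ i → {0, 1}` -/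
  halt : (i : ℕ) → (Fin i → K) → Bool
  /-- `output i` is `φ_i : K ^ i → G` -/
  output : (i : ℕ) → (Fin i → K) → G

namespace DetAlgorithm

variable {F G K : Type*} {P : Problem F G K}

/-- The information `(λ₁(f), …, λ_i(f))`, where `λ_{i+1} = L_{i+1}(λ₁(f), …, λ_i(f))`. -/
def values (A : DetAlgorithm P) (f : F) : (i : ℕ) → Fin i → K
  | 0 => Fin.elim0
  | i + 1 => Fin.snoc (α := fun _ => K) (A.values f i) ((A.query i (A.values f i)).1 f)

/-- The cardinality at input `f`: the first `i ≥ 0` at which the algorithm halts, and `∞` if there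
is none. -/
def card (A : DetAlgorithm P) (f : F) : ℕ∞ :=
  ⨅ (i : ℕ) (_ : A.halt i (A.values f i) = true), (i : ℕ∞)

/-- The output at input `f`: `φ_n(λ₁(f), …, λ_n(f))` if the cardinality is a finite `n`, and `φ₀`
if the cardinality is infinite (`ENat.toNat ⊤ = 0`). -/
def eval (A : DetAlgorithm P) (f : F) : G :=
  A.output (A.card f).toNat (A.values f (A.card f).toNat)

/-- All `L_i` and all `τ_i` are constant. -/
def NonAdaptive (A : DetAlgorithm P) : Prop :=
  ∀ (i : ℕ) (x y : Fin i → K), A.query i x = A.query i y ∧ A.halt i x = A.halt i y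

end DetAlgorithm

/-- A randomized algorithm: a family of deterministic algorithms indexed by a probability space. -/
structure RandAlgorithm {F G K : Type*} (P : Problem F G K) where
  /-- the sample space -/
  Ω : Type u
  /-- its `σ`-algebra -/
  mΩ : MeasurableSpace Ω
  /-- its probability measure -/
  μ : Measure Ω
  isProb : IsProbabilityMeasure μ
  /-- the deterministic algorithms `A_ω` -/
  alg : Ω → DetAlgorithm P

namespace RandAlgorithm

variable {F G K : Type*} [NormedAddCommGroup G] {P : Problem F G K}

/-- The class of randomized algorithms of cardinality at most `n`: for each input `f` the map
`ω ↦ card(A_ω, f)` is measurable with expectation at most `n`, and `ω ↦ A_ω(f)` is Borel measurable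
and almost surely separably valued. -/
def CardLE (A : RandAlgorithm.{u} P) (n : ℕ) : Prop :=
  ∀ f : F,
    Measurable[A.mΩ] (fun ω => (A.alg ω).card f) ∧
    ∫⁻ ω, (((A.alg ω).card f : ℕ∞) : ℝ≥0∞) ∂A.μ ≤ (n : ℝ≥0∞) ∧
    Measurable[A.mΩ, borel G] (fun ω => (A.alg ω).eval f) ∧
    ∃ s : Set G, TopologicalSpace.IsSeparable s ∧ ∀ᵐ ω ∂A.μ, (A.alg ω).eval f ∈ s

/-- `A_ω` is non-adaptive for all `ω`. -/
def NonAdaptive {F G K : Type*} {P : Problem F G K} (A : RandAlgorithm.{u} P) : Prop :=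
  ∀ ω, (A.alg ω).NonAdaptive

/-- The worst-case expected error `sup_f 𝔼 ‖S(f) - A_ω(f)‖`. -/
def error (A : RandAlgorithm.{u} P) : ℝ≥0∞ :=
  ⨆ f : F, ∫⁻ ω, ‖P.sol f - (A.alg ω).eval f‖ₑ ∂A.μ

end RandAlgorithm

/-- The (adaptive) randomized `n`-th minimal error. -/
def ranError {F G K : Type*} [NormedAddCommGroup G] (n : ℕ) (P : Problem F G K) : ℝ≥0∞ :=
  ⨅ (A : RandAlgorithm.{u} P) (_ : A.CardLE n), A.error

/-- The non-adaptive randomized `n`-th minimal error. -/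
def ranNonError {F G K : Type*} [NormedAddCommGroup G] (n : ℕ) (P : Problem F G K) : ℝ≥0∞ :=
  ⨅ (A : RandAlgorithm.{u} P) (_ : A.CardLE n) (_ : A.NonAdaptive), A.error

/-! ### Vector-valued approximation -/

/-- Approximation of the embedding `J f = f` of `L_p^{N₁}(L_u^{N₂})` into `L_q^{N₁}(L_v^{N₂})` on
the closed unit ball of the source space, from function values `δ_{ij}(f) = f(i, j)`. -/
def vectorApprox (𝕜 : Type*) [RCLike 𝕜] (p u q v : ℝ≥0∞) [Fact (1 ≤ p)] [Fact (1 ≤ u)]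
    (N₁ N₂ : ℕ+) :
    Problem (Metric.closedBall (0 : LSpace p N₁ (LSpace u N₂ 𝕜)) 1)
      (LSpace q N₁ (LSpace v N₂ 𝕜)) 𝕜 where
  sol := fun f i j => f.1 i j
  info := {δ | ∃ (i : Fin N₁) (j : Fin N₂), δ = fun f => f.1 i j}
  info_nonempty := ⟨_, ⟨0, N₁.pos⟩, ⟨0, N₂.pos⟩, rfl⟩

end

end IBC

namespace IBC

noncomputable section

/-! Since `N` exceeds `2√n`, at most a quarter of the `N²` entries can be read on average. The
adaptive error turns out to lie between two positive constants and the non-adaptive one between two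
multiples of `N`, so the quotient has order `√n`, even without the logarithm in the lower estimate.

Lower bounds average over random signs: flipping the sign at an unread position leaves the output
unchanged. Signs of height `1` everywhere force a constant error (`sq_le_ranError`). Without
adaption the queries cannot react to which row carries the mass, so a single row of height `N`,
averaged over all rows, forces an error of order `N` (`sq_le_ranNonError`). The zero algorithm
already achieves `N` (`ranNonError_le`).

The adaptive upper bound screens every row at `k` random columns and then reads completely each row
showing a value above `T`. By Markov there are at most `N / T` such rows. A row with mean above `2
T` is missed with small probability relative to its maximum (`mean_mul_pow_le`); since the maxima
sum to at most `N`, the expected error is at most `2 T + 2 N / k` (`ranError_le_of_screening`), a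
constant for `k` of order `n / N`. -/

theorem LSpace.norm_top {N : ℕ} {E : Type*} [NormedAddCommGroup E] (f : LSpace ∞ N E) :
    ‖f‖ = ⨆ i, ‖f i‖ := by
  simp [LSpace.norm_def, meanNorm]

theorem LSpace.norm_one {N : ℕ} {E : Type*} [NormedAddCommGroup E] (f : LSpace 1 N E) :
    ‖f‖ = (1 / (N : ℝ)) * ∑ i, ‖f i‖ := by
  simp [LSpace.norm_def, meanNorm]

theorem LSpace.norm_apply_le {N : ℕ} {E : Type*} [NormedAddCommGroup E] (f : LSpace ∞ N E)
    (i : Fin N) : ‖f i‖ ≤ ‖f‖ := by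
  rw [LSpace.norm_top]
  exact le_ciSup (f := fun i => ‖f i‖) (Set.finite_range _).bddAbove i

theorem LSpace.norm_top_le {N : ℕ} {E : Type*} [NormedAddCommGroup E] (f : LSpace ∞ N E) {r : ℝ}
    (hr : 0 ≤ r) (h : ∀ i, ‖f i‖ ≤ r) : ‖f‖ ≤ r := by
  rw [LSpace.norm_top]
  exact Real.iSup_le h hr

theorem LSpace.card_mul_norm {N : ℕ} (hN : 0 < N) {E : Type*} [NormedAddCommGroup E]
    (f : LSpace 1 N E) : N * ‖f‖ = ∑ i, ‖f i‖ := by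
  rw [LSpace.norm_one]
  field_simp

theorem LSpace.card_mul_enorm {N : ℕ} (hN : 0 < N) {E : Type*} [NormedAddCommGroup E]
    (f : LSpace 1 N E) : N * ‖f‖ₑ = ∑ i, ‖f i‖ₑ := by
  simp only [← ofReal_norm]
  have h := ENNReal.ofReal_sum_of_nonneg (s := Finset.univ) (f := fun i => ‖f i‖)
    fun i _ => norm_nonneg _
  rw [← LSpace.card_mul_norm hN, ENNReal.ofReal_mul (by positivity), ENNReal.ofReal_natCast] at h
  exact h

theorem LSpace.sum_enorm_le {N : ℕ} (hN : 0 < N) {M : ℕ} {E : Type*} [NormedAddCommGroup E]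
    (f : LSpace ∞ M (LSpace 1 N E)) (i : Fin M) : ∑ j, ‖f i j‖ₑ ≤ N * ‖f‖ₑ := by
  rw [← LSpace.card_mul_enorm hN]
  gcongr
  rw [← ofReal_norm, ← ofReal_norm]
  exact ENNReal.ofReal_le_ofReal (LSpace.norm_apply_le f i)

/-! ### Runs of deterministic algorithms on indistinguishable inputs. -/

namespace DetAlgorithm

variable {F G K : Type*} {P : Problem F G K}

theorem values_apply (A : DetAlgorithm P) (f : F) (i : ℕ) (t : Fin i) :
    A.values f i t = (A.query t (A.values f t)).1 f := by
  induction i with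
  | zero => exact t.elim0
  | succ i ih =>
    refine Fin.lastCases ?_ (fun t => ?_) t
    · simp [values]
    · simp [values, ih]

theorem card_le (A : DetAlgorithm P) {f : F} {i : ℕ} (h : A.halt i (A.values f i) = true) :
    A.card f ≤ i := iInf₂_le i h

theorem halt_of_card_eq (A : DetAlgorithm P) {f : F} {n : ℕ} (h : A.card f = n) :
    A.halt n (A.values f n) = true := by
  by_contra hn
  have : ((n + 1 : ℕ) : ℕ∞) ≤ A.card f := by
    refine le_iInf₂ fun i hi => ?_
    have h1 : (n : ℕ∞) ≤ i := h ▸ A.card_le hi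
    have h2 : n ≤ i := by exact_mod_cast h1
    rcases h2.eq_or_lt with h3 | h3
    · subst h3; exact absurd hi hn
    · exact_mod_cast h3
  rw [h] at this
  have : n + 1 ≤ n := by exact_mod_cast this
  omega

theorem values_congr (A : DetAlgorithm P) {f g : F}
    (h : ∀ i : ℕ, (i : ℕ∞) < A.card f →
      (A.query i (A.values f i)).1 g = (A.query i (A.values f i)).1 f)
    (i : ℕ) (hi : (i : ℕ∞) ≤ A.card f) : A.values g i = A.values f i := by
  induction i with
  | zero => rfl
  | succ i ih =>
    have hlt : (i : ℕ∞) < A.card f := lt_of_lt_of_le (by exact_mod_cast i.lt_succ_self) hi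
    simp [values, ih hlt.le, h i hlt]

theorem card_congr (A : DetAlgorithm P) {f g : F}
    (h : ∀ i : ℕ, (i : ℕ∞) < A.card f →
      (A.query i (A.values f i)).1 g = (A.query i (A.values f i)).1 f) :
    A.card g = A.card f := by
  apply le_antisymm
  · rcases hc : A.card f with _ | n
    · exact le_top
    · apply A.card_le
      rw [A.values_congr h n (by rw [hc]; rfl)]
      exact A.halt_of_card_eq hc
  · refine le_iInf₂ fun i hi => ?_
    by_contra hlt
    rw [not_le] at hlt
    rw [A.values_congr h i hlt.le] at hi
    exact absurd (A.card_le hi) (not_le.2 hlt)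

theorem eval_congr (A : DetAlgorithm P) {f g : F}
    (h : ∀ i : ℕ, (i : ℕ∞) < A.card f →
      (A.query i (A.values f i)).1 g = (A.query i (A.values f i)).1 f) :
    A.eval g = A.eval f := by
  unfold eval
  -- This also covers infinite cardinality, where `toNat` gives `0`.
  rw [A.card_congr h, A.values_congr h _ (ENat.natCast_toNat_le_self _)]

theorem NonAdaptive.card_eq {A : DetAlgorithm P} (hA : A.NonAdaptive) (f g : F) :
    A.card f = A.card g := by
  unfold card
  congr! 3 with i
  rw [(hA i (A.values f i) (A.values g i)).2]

end DetAlgorithm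

/-! ### Lower bounds by random signs. -/

section LowerBounds

variable {𝕜 : Type v} [RCLike 𝕜] {N : ℕ+}

/-- The position read by a function value. -/
def position (δ : (vectorApprox 𝕜 1 ∞ ∞ 1 N N).info) : Fin N × Fin N :=
  (δ.2.choose, δ.2.choose_spec.choose)

theorem apply_position (δ : (vectorApprox 𝕜 1 ∞ ∞ 1 N N).info)
    (f : Metric.closedBall (0 : LSpace 1 N (LSpace ∞ N 𝕜)) 1) :
    δ.1 f = f.1 (position δ).1 (position δ).2 :=
  congrFun δ.2.choose_spec.choose_spec f

open Classical in
/-- The positions at which an algorithm reads its input before it halts. -/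
def queried (A : DetAlgorithm (vectorApprox 𝕜 1 ∞ ∞ 1 N N))
    (f : Metric.closedBall (0 : LSpace 1 N (LSpace ∞ N 𝕜)) 1) : Finset (Fin N × Fin N) :=
  {p | ∃ i : ℕ, (i : ℕ∞) < A.card f ∧ position (A.query i (A.values f i)) = p}

theorem mem_queried {A : DetAlgorithm (vectorApprox 𝕜 1 ∞ ∞ 1 N N)}
    {f : Metric.closedBall (0 : LSpace 1 N (LSpace ∞ N 𝕜)) 1} {p : Fin N × Fin N} :
    p ∈ queried A f ↔
      ∃ i : ℕ, (i : ℕ∞) < A.card f ∧ position (A.query i (A.values f i)) = p := by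
  simp [queried]

theorem card_queried_le (A : DetAlgorithm (vectorApprox 𝕜 1 ∞ ∞ 1 N N))
    (f : Metric.closedBall (0 : LSpace 1 N (LSpace ∞ N 𝕜)) 1) :
    ((queried A f).card : ℝ≥0∞) ≤ ((A.card f : ℕ∞) : ℝ≥0∞) := by
  classical
  rcases hc : A.card f with _ | n
  · exact le_top
  · have hsub : queried A f ⊆
        (Finset.range n).image fun i => position (A.query i (A.values f i)) := by
      intro p hp
      obtain ⟨i, hi, hip⟩ := mem_queried.1 hp
      rw [hc] at hi
      have hi' : i < n := by exact_mod_cast (show (i : ℕ∞) < (n : ℕ∞) from hi)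
      exact Finset.mem_image.2 ⟨i, Finset.mem_range.2 hi', hip⟩
    have h := (Finset.card_le_card hsub).trans Finset.card_image_le
    rw [Finset.card_range] at h
    change ((queried A f).card : ℝ≥0∞) ≤ (((n : ℕ) : ℕ∞) : ℝ≥0∞)
    rw [ENat.toENNReal_coe]
    exact_mod_cast h

/-- The only way in which non-adaptivity enters the lower bound. -/
theorem NonAdaptive.queried_eq {A : DetAlgorithm (vectorApprox 𝕜 1 ∞ ∞ 1 N N)}
    (hA : A.NonAdaptive) (f g : Metric.closedBall (0 : LSpace 1 N (LSpace ∞ N 𝕜)) 1) :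
    queried A f = queried A g := by
  ext p
  simp only [mem_queried, hA.card_eq f g]
  refine exists_congr fun i => ?_
  rw [(hA i (A.values f i) (A.values g i)).1]

/-- A matrix whose `i`-th row has entries `± r i`. -/
def signMatrix (𝕜 : Type v) [RCLike 𝕜] (N : ℕ+) (r : Fin N → ℕ) (ε : Fin N × Fin N → Bool) :
    LSpace 1 N (LSpace ∞ N 𝕜) :=
  fun i j => if ε (i, j) then (r i : 𝕜) else -(r i : 𝕜)

theorem signMatrix_mem {r : Fin N → ℕ} (hr : ∑ i, r i ≤ N) (ε : Fin N × Fin N → Bool) :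
    signMatrix 𝕜 N r ε ∈ Metric.closedBall (0 : LSpace 1 N (LSpace ∞ N 𝕜)) 1 := by
  rw [mem_closedBall_zero_iff]
  have hN : (0 : ℝ) < (N : ℕ) := by exact_mod_cast N.pos
  have h1 := LSpace.card_mul_norm N.pos (signMatrix 𝕜 N r ε)
  have h2 : ∑ i, ‖signMatrix 𝕜 N r ε i‖ ≤ ∑ i, (r i : ℝ) := by
    refine Finset.sum_le_sum fun i _ => LSpace.norm_top_le _ (by positivity) fun j => ?_
    unfold signMatrix
    split_ifs <;> simp
  have h3 : ∑ i, (r i : ℝ) ≤ (N : ℕ) := by exact_mod_cast hr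
  have : ((N : ℕ) : ℝ) * ‖signMatrix 𝕜 N r ε‖ ≤ (N : ℕ) * 1 := by linarith
  exact le_of_mul_le_mul_left this hN

/-- `signMatrix` as an element of the unit ball. -/
def signInput (𝕜 : Type v) [RCLike 𝕜] {r : Fin N → ℕ} (hr : ∑ i, r i ≤ N)
    (ε : Fin N × Fin N → Bool) : Metric.closedBall (0 : LSpace 1 N (LSpace ∞ N 𝕜)) 1 :=
  ⟨signMatrix 𝕜 N r ε, signMatrix_mem hr ε⟩

/-- Change the sign at one position. -/
def flipAt (p : Fin N × Fin N) (ε : Fin N × Fin N → Bool) : Fin N × Fin N → Bool :=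
  Function.update ε p (!ε p)

theorem flipAt_flipAt (p : Fin N × Fin N) : Function.Involutive (flipAt p) := by
  intro ε
  simp [flipAt]

/-- The error at position `p` on the input `f`. -/
def errorAt (A : DetAlgorithm (vectorApprox 𝕜 1 ∞ ∞ 1 N N))
    (f : Metric.closedBall (0 : LSpace 1 N (LSpace ∞ N 𝕜)) 1) (p : Fin N × Fin N) : ℝ≥0∞ :=
  ‖f.1 p.1 p.2 - A.eval f p.1 p.2‖ₑ

/-- The two inputs differ only at the unread `p`, so they share one output; their entries at `p` are
`2 r` apart, and the triangle inequality applies. -/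
theorem two_mul_le_errorAt_add (A : DetAlgorithm (vectorApprox 𝕜 1 ∞ ∞ 1 N N)) {r : Fin N → ℕ}
    (hr : ∑ i, r i ≤ N) (ε : Fin N × Fin N → Bool) {p : Fin N × Fin N}
    (hp : p ∉ queried A (signInput 𝕜 hr ε)) :
    2 * (r p.1 : ℝ≥0∞) ≤
      errorAt A (signInput 𝕜 hr ε) p + errorAt A (signInput 𝕜 hr (flipAt p ε)) p := by
  have heval : A.eval (signInput 𝕜 hr (flipAt p ε)) = A.eval (signInput 𝕜 hr ε) := by
    refine A.eval_congr fun i hi => ?_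
    rw [apply_position, apply_position]
    have hne : position (A.query i (A.values (signInput 𝕜 hr ε) i)) ≠ p :=
      fun h => hp (mem_queried.2 ⟨i, hi, h⟩)
    generalize position (A.query i (A.values (signInput 𝕜 hr ε) i)) = q at hne ⊢
    have hq : flipAt p ε (q.1, q.2) = ε (q.1, q.2) := Function.update_of_ne hne _ _
    simp only [signInput, signMatrix, hq]
  unfold errorAt
  rw [heval]
  have h := edist_triangle_right ((signInput 𝕜 hr ε).1 p.1 p.2 : 𝕜)
    ((signInput 𝕜 hr (flipAt p ε)).1 p.1 p.2) (A.eval (signInput 𝕜 hr ε) p.1 p.2)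
  simp only [edist_eq_enorm_sub] at h
  refine le_trans (le_of_eq ?_) h
  have hnorm : ‖(r p.1 : 𝕜) + (r p.1 : 𝕜)‖ = 2 * r p.1 := by
    rw [← two_mul, norm_mul]; simp
  have hreal : ‖((signInput 𝕜 hr ε).1 p.1 p.2 : 𝕜) -
      (signInput 𝕜 hr (flipAt p ε)).1 p.1 p.2‖ = 2 * r p.1 := by
    rw [← hnorm]
    cases hε : ε p
    · simp only [signInput, signMatrix, flipAt, hε, Function.update_self]
      rw [← norm_neg]
      congr 1
      simp
    · simp [signInput, signMatrix, flipAt, hε]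
  rw [← ofReal_norm, hreal, ENNReal.ofReal_mul (by norm_num)]
  simp

-- Flipping at `p` permutes the sign patterns, so both errors in `two_mul_le_errorAt_add` have the
-- same sum over all patterns. Patterns for which `p` is read are paid for by the last sum.
open Classical in
theorem mul_card_le_sum_errorAt (A : DetAlgorithm (vectorApprox 𝕜 1 ∞ ∞ 1 N N)) {r : Fin N → ℕ}
    (hr : ∑ i, r i ≤ N) (p : Fin N × Fin N) :
    ∑ _ε : Fin N × Fin N → Bool, (r p.1 : ℝ≥0∞) ≤
      ∑ ε, errorAt A (signInput 𝕜 hr ε) p +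
        ∑ ε, if p ∈ queried A (signInput 𝕜 hr ε) then (r p.1 : ℝ≥0∞) else 0 := by
  have hflip : ∑ ε, errorAt A (signInput 𝕜 hr (flipAt p ε)) p =
      ∑ ε, errorAt A (signInput 𝕜 hr ε) p :=
    Equiv.sum_comp (flipAt_flipAt p).toPerm fun ε => errorAt A (signInput 𝕜 hr ε) p
  have h : ∀ ε : Fin N × Fin N → Bool, 2 * (r p.1 : ℝ≥0∞) ≤
      (errorAt A (signInput 𝕜 hr ε) p + errorAt A (signInput 𝕜 hr (flipAt p ε)) p) +
        2 * if p ∈ queried A (signInput 𝕜 hr ε) then (r p.1 : ℝ≥0∞) else 0 := by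
    intro ε
    split_ifs with hp
    · exact le_add_self
    · simpa using two_mul_le_errorAt_add A hr ε hp
  have hs := Finset.sum_le_sum fun ε (_ : ε ∈ Finset.univ) => h ε
  rw [Finset.sum_add_distrib, Finset.sum_add_distrib, hflip, ← two_mul, ← Finset.mul_sum,
    ← Finset.mul_sum, ← mul_add] at hs
  exact (ENNReal.mul_le_mul_iff_right (by norm_num) (by norm_num)).1 hs

theorem sum_errorAt_row_le (A : DetAlgorithm (vectorApprox 𝕜 1 ∞ ∞ 1 N N))
    (f : Metric.closedBall (0 : LSpace 1 N (LSpace ∞ N 𝕜)) 1) (i : Fin N) :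
    ∑ j, errorAt A f (i, j) ≤
      (N : ℕ) * ‖(vectorApprox 𝕜 1 ∞ ∞ 1 N N).sol f - A.eval f‖ₑ :=
  LSpace.sum_enorm_le N.pos ((vectorApprox 𝕜 1 ∞ ∞ 1 N N).sol f - A.eval f) i

/-- The two height profiles of the hard inputs: mass spread over all rows (adaptive case) and
concentrated in one row (non-adaptive case). -/
theorem sum_one_le : ∑ _i : Fin N, (fun _ => 1 : Fin N → ℕ) _i ≤ N := by simp

theorem sum_single_le (i : Fin N) : ∑ l, (Pi.single i (N : ℕ) : Fin N → ℕ) l ≤ N := by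
  simp [Finset.sum_pi_single']

theorem adaptive_error_add_card_ge (A : DetAlgorithm (vectorApprox 𝕜 1 ∞ ∞ 1 N N)) :
    ∑ _ε : Fin N × Fin N → Bool, ((N : ℕ) * (N : ℕ) : ℝ≥0∞) ≤
      ∑ ε, ((N : ℕ) * (N : ℕ) : ℝ≥0∞) * ‖(vectorApprox 𝕜 1 ∞ ∞ 1 N N).sol
        (signInput 𝕜 sum_one_le ε) - A.eval (signInput 𝕜 sum_one_le ε)‖ₑ +
      ∑ ε, ((A.card (signInput 𝕜 sum_one_le ε) : ℕ∞) : ℝ≥0∞) := by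
  classical
  have h := Finset.sum_le_sum fun p (_ : p ∈ Finset.univ) =>
    mul_card_le_sum_errorAt (𝕜 := 𝕜) A sum_one_le p
  rw [Finset.sum_add_distrib, Finset.sum_comm, Finset.sum_comm (f := fun p ε => errorAt A _ p),
    Finset.sum_comm (s := Finset.univ (α := Fin N × Fin N))] at h
  refine le_trans (le_of_eq ?_) (h.trans (add_le_add ?_ ?_))
  · simp
  · refine Finset.sum_le_sum fun ε _ => ?_
    rw [Fintype.sum_prod_type]
    refine (Finset.sum_le_sum fun i _ => sum_errorAt_row_le A _ i).trans (le_of_eq ?_)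
    simp [mul_assoc]
  · refine Finset.sum_le_sum fun ε _ => le_trans (le_of_eq ?_) (card_queried_le A _)
    simp

/-- Position `p` is tested with the input supported on its own row. The inputs vary with the row,
but the set of read positions does not, so it is counted only once over all rows. -/
theorem nonAdaptive_error_add_card_ge (A : DetAlgorithm (vectorApprox 𝕜 1 ∞ ∞ 1 N N))
    (hA : A.NonAdaptive) (f₀ : Metric.closedBall (0 : LSpace 1 N (LSpace ∞ N 𝕜)) 1) :
    ∑ _ε : Fin N × Fin N → Bool, ((N : ℕ) * (N : ℕ) : ℝ≥0∞) ≤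
      ∑ ε, ∑ i, ‖(vectorApprox 𝕜 1 ∞ ∞ 1 N N).sol
        (signInput 𝕜 (sum_single_le i) ε) - A.eval (signInput 𝕜 (sum_single_le i) ε)‖ₑ +
      ∑ _ε : Fin N × Fin N → Bool, ((A.card f₀ : ℕ∞) : ℝ≥0∞) := by
  classical
  have hN0 : ((N : ℕ) : ℝ≥0∞) ≠ 0 := by simp
  have h : ∀ p : Fin N × Fin N, _ := fun p =>
    mul_card_le_sum_errorAt (𝕜 := 𝕜) A (sum_single_le p.1) p
  simp only [NonAdaptive.queried_eq hA _ f₀, Pi.single_eq_same] at h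
  have hs := Finset.sum_le_sum fun p (_ : p ∈ Finset.univ) => h p
  rw [Finset.sum_add_distrib, Finset.sum_comm,
    Finset.sum_comm (f := fun p ε => errorAt A _ p),
    Finset.sum_comm (s := Finset.univ (α := Fin N × Fin N))] at hs
  have hs' := hs.trans (add_le_add
    (b := (N : ℕ) * ∑ ε, ∑ i, ‖(vectorApprox 𝕜 1 ∞ ∞ 1 N N).sol
        (signInput 𝕜 (sum_single_le i) ε) - A.eval (signInput 𝕜 (sum_single_le i) ε)‖ₑ)
    (d := (N : ℕ) * ∑ _ε : Fin N × Fin N → Bool, ((A.card f₀ : ℕ∞) : ℝ≥0∞)) ?_ ?_)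
  · rw [← mul_add] at hs'
    refine (ENNReal.mul_le_mul_iff_right hN0 (by simp)).1 (le_trans (le_of_eq ?_) hs')
    simp only [Finset.sum_const, Finset.card_univ, Fintype.card_prod, Fintype.card_fin,
      nsmul_eq_mul, Nat.cast_mul]
    ring
  · rw [Finset.mul_sum]
    refine Finset.sum_le_sum fun ε _ => ?_
    rw [Fintype.sum_prod_type, Finset.mul_sum]
    exact Finset.sum_le_sum fun i _ => sum_errorAt_row_le A _ i
  · rw [Finset.mul_sum]
    refine Finset.sum_le_sum fun ε _ => le_trans (le_of_eq ?_)
      (mul_le_mul_right (card_queried_le A f₀) _)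
    simp [mul_comm]

/-! ### Passing from deterministic averages to randomized errors. -/

theorem RandAlgorithm.CardLE.measurable_error {F G K : Type*} [NormedAddCommGroup G]
    {P : Problem F G K} {A : RandAlgorithm.{u} P} {n : ℕ} (hA : A.CardLE n) (f : F) :
    Measurable[A.mΩ] fun ω => ‖P.sol f - (A.alg ω).eval f‖ₑ := by
  let := A.mΩ
  let : MeasurableSpace G := borel G
  have : BorelSpace G := ⟨rfl⟩
  have hc : Continuous fun y : G => ‖P.sol f - y‖ₑ := by fun_prop
  exact hc.measurable.comp (hA f).2.2.1

theorem RandAlgorithm.CardLE.measurable_card {F G K : Type*} [NormedAddCommGroup G]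
    {P : Problem F G K} {A : RandAlgorithm.{u} P} {n : ℕ} (hA : A.CardLE n) (f : F) :
    Measurable[A.mΩ] fun ω => (((A.alg ω).card f : ℕ∞) : ℝ≥0∞) := by
  let := A.mΩ
  exact (Measurable.of_discrete (f := fun c : ℕ∞ => (c : ℝ≥0∞))).comp (hA f).1

theorem RandAlgorithm.lintegral_le_error {F G K : Type*} [NormedAddCommGroup G]
    {P : Problem F G K} (A : RandAlgorithm.{u} P) (f : F) :
    ∫⁻ ω, ‖P.sol f - (A.alg ω).eval f‖ₑ ∂A.μ ≤ A.error :=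
  le_iSup (fun f => ∫⁻ ω, ‖P.sol f - (A.alg ω).eval f‖ₑ ∂A.μ) f

theorem sq_le_ranError (n : ℕ) :
    ((N : ℕ) * (N : ℕ) : ℝ≥0∞) ≤ (N : ℕ) * (N : ℕ) *
      ranError.{u} n (vectorApprox 𝕜 1 ∞ ∞ 1 N N) + n := by
  -- Isolating the minimal error on one side lets the bound be checked algorithm by algorithm under
  -- the infimum.
  suffices h : ((N : ℕ) * (N : ℕ) - n : ℝ≥0∞) / ((N : ℕ) * (N : ℕ)) ≤
      ranError.{u} n (vectorApprox 𝕜 1 ∞ ∞ 1 N N) by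
    rw [ENNReal.div_le_iff' (by simp) (ENNReal.mul_ne_top (by simp) (by simp))] at h
    exact tsub_le_iff_right.1 h
  refine le_iInf₂ fun A hA => ?_
  rw [ENNReal.div_le_iff' (by simp) (ENNReal.mul_ne_top (by simp) (by simp)), tsub_le_iff_right]
  let := A.mΩ
  have := A.isProb
  have h := lintegral_mono (μ := A.μ) fun ω => adaptive_error_add_card_ge (A.alg ω)
  rw [lintegral_add_left (Finset.measurable_fun_sum _ fun ε _ =>
      (hA.measurable_error _).const_mul _),
    lintegral_finsetSum _ fun ε _ => (hA.measurable_error _).const_mul _,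
    lintegral_finsetSum _ fun ε _ => hA.measurable_card _] at h
  have h2 : ∑ _ε : Fin N × Fin N → Bool, ((N : ℕ) * (N : ℕ) : ℝ≥0∞) ≤
      ∑ _ε : Fin N × Fin N → Bool, ((N : ℕ) * (N : ℕ) * A.error + n : ℝ≥0∞) := by
    rw [lintegral_const, measure_univ, mul_one] at h
    refine h.trans ?_
    rw [Finset.sum_add_distrib]
    refine add_le_add (Finset.sum_le_sum fun ε _ => ?_)
      (Finset.sum_le_sum fun ε _ => (hA _).2.1)
    rw [lintegral_const_mul _ (hA.measurable_error _)]
    gcongr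
    exact A.lintegral_le_error _
  rw [Finset.sum_const, Finset.sum_const, nsmul_eq_mul, nsmul_eq_mul] at h2
  exact (ENNReal.mul_le_mul_iff_right (by simp) (by simp)).1 h2

theorem sq_le_ranNonError (n : ℕ) :
    ((N : ℕ) * (N : ℕ) : ℝ≥0∞) ≤
      (N : ℕ) * ranNonError.{u} n (vectorApprox 𝕜 1 ∞ ∞ 1 N N) + n := by
  suffices h : ((N : ℕ) * (N : ℕ) - n : ℝ≥0∞) / (N : ℕ) ≤
      ranNonError.{u} n (vectorApprox 𝕜 1 ∞ ∞ 1 N N) by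
    rw [ENNReal.div_le_iff' (by simp) (by simp)] at h
    exact tsub_le_iff_right.1 h
  refine le_iInf₂ fun A hA => le_iInf fun hnon => ?_
  rw [ENNReal.div_le_iff' (by simp) (by simp), tsub_le_iff_right]
  let := A.mΩ
  have := A.isProb
  let f₀ : Metric.closedBall (0 : LSpace 1 N (LSpace ∞ N 𝕜)) 1 := ⟨0, by simp⟩
  have h := lintegral_mono (μ := A.μ) fun ω => nonAdaptive_error_add_card_ge (A.alg ω) (hnon ω) f₀
  rw [lintegral_add_left (Finset.measurable_fun_sum _ fun ε _ => Finset.measurable_fun_sum _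
      fun i _ => hA.measurable_error _),
    lintegral_finsetSum _ fun ε _ => Finset.measurable_fun_sum _ fun i _ => hA.measurable_error _,
    lintegral_finsetSum _ fun ε _ => hA.measurable_card _] at h
  have h2 : ∑ _ε : Fin N × Fin N → Bool, ((N : ℕ) * (N : ℕ) : ℝ≥0∞) ≤
      ∑ _ε : Fin N × Fin N → Bool, ((N : ℕ) * A.error + n : ℝ≥0∞) := by
    rw [lintegral_const, measure_univ, mul_one] at h
    refine h.trans ?_
    rw [Finset.sum_add_distrib]
    refine add_le_add (Finset.sum_le_sum fun ε _ => ?_)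
      (Finset.sum_le_sum fun ε _ => (hA _).2.1)
    rw [lintegral_finsetSum _ fun i _ => hA.measurable_error _]
    refine (Finset.sum_le_sum fun i _ => A.lintegral_le_error _).trans (le_of_eq ?_)
    simp
  rw [Finset.sum_const, Finset.sum_const, nsmul_eq_mul, nsmul_eq_mul] at h2
  exact (ENNReal.mul_le_mul_iff_right (by simp) (by simp)).1 h2

end LowerBounds

/-! ### Comparison of the two errors and the zero algorithm. -/

theorem ranError_le_ranNonError {F G K : Type*} [NormedAddCommGroup G] (n : ℕ)
    (P : Problem F G K) : ranError.{u} n P ≤ ranNonError.{u} n P :=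
  iInf₂_mono fun _ _ => le_iInf fun _ => le_rfl

/-- The algorithm that uses no information and returns `0`. -/
def DetAlgorithm.zero {F G K : Type*} [Zero G] (P : Problem F G K) : DetAlgorithm P where
  query _ _ := ⟨_, P.info_nonempty.some_mem⟩
  halt _ _ := true
  output _ _ := 0

theorem ranNonError_le_of_norm_le {F G K : Type*} [NormedAddCommGroup G] (n : ℕ)
    (P : Problem F G K) {r : ℝ≥0∞} (hr : ∀ f, ‖P.sol f‖ₑ ≤ r) : ranNonError.{u} n P ≤ r := by
  let A : RandAlgorithm.{u} P :=
    { Ω := PUnit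
      mΩ := ⊤
      μ := @Measure.dirac _ ⊤ PUnit.unit
      isProb := by infer_instance
      alg := fun _ => DetAlgorithm.zero P }
  have hcard : ∀ f, (DetAlgorithm.zero P).card f = 0 := fun f =>
    nonpos_iff_eq_zero.1 ((DetAlgorithm.zero P).card_le (i := 0) rfl)
  have hA : A.CardLE n := fun f =>
    ⟨fun _ _ => trivial, by simp [A, hcard], fun _ _ => trivial, {0},
      (Set.finite_singleton _).isSeparable, by simp [A, DetAlgorithm.eval, DetAlgorithm.zero]⟩
  refine (iInf₂_le_of_le A hA (iInf_le_of_le (fun _ _ _ _ => ⟨rfl, rfl⟩) le_rfl)).trans ?_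
  refine iSup_le fun f => ?_
  simpa [A, DetAlgorithm.eval, DetAlgorithm.zero] using hr f

/-! ### Two-phase algorithms and the screening of rows. -/

section UpperBounds

variable {𝕜 : Type v} [RCLike 𝕜] {N : ℕ+}

theorem sum_norm_row_le (f : Metric.closedBall (0 : LSpace 1 N (LSpace ∞ N 𝕜)) 1) :
    ∑ i, ‖f.1 i‖ ≤ (N : ℕ) := by
  rw [← LSpace.card_mul_norm N.pos]
  exact mul_le_of_le_one_right (by positivity) (mem_closedBall_zero_iff.1 f.2)

theorem enorm_sol_le (f : Metric.closedBall (0 : LSpace 1 N (LSpace ∞ N 𝕜)) 1) :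
    ‖(vectorApprox 𝕜 1 ∞ ∞ 1 N N).sol f‖ₑ ≤ (N : ℕ) := by
  rw [← ofReal_norm, ← ENNReal.ofReal_natCast]
  refine ENNReal.ofReal_le_ofReal (LSpace.norm_top_le _ (by positivity) fun i => ?_)
  have hN : (0 : ℝ) < (N : ℕ) := by exact_mod_cast N.pos
  refine le_of_mul_le_mul_left ?_ hN
  rw [LSpace.card_mul_norm N.pos]
  have h : ∀ j, ‖(vectorApprox 𝕜 1 ∞ ∞ 1 N N).sol f i j‖ ≤ (N : ℕ) := fun j =>
    (LSpace.norm_apply_le (f.1 i) j).trans ((Finset.single_le_sum (f := fun i => ‖f.1 i‖)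
      (fun i _ => norm_nonneg _) (Finset.mem_univ i)).trans (sum_norm_row_le f))
  refine (Finset.sum_le_sum fun j _ => h j).trans (le_of_eq ?_)
  simp

/-- The function value at a position. -/
def valueAt (𝕜 : Type v) [RCLike 𝕜] {N : ℕ+} (p : Fin N × Fin N) :
    (vectorApprox 𝕜 1 ∞ ∞ 1 N N).info :=
  ⟨fun f => f.1 p.1 p.2, p.1, p.2, rfl⟩

open Classical in
/-- The algorithm that reads `len` entries, the next position being determined by `pos`, and returns
the matrix of all known entries, completed by zeros. -/
def ofPositions (pos : (i : ℕ) → (Fin i → 𝕜) → Fin N × Fin N) (len : ℕ) :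
    DetAlgorithm (vectorApprox 𝕜 1 ∞ ∞ 1 N N) where
  query i x := valueAt 𝕜 (pos i x)
  halt i _ := decide (i = len)
  output i x a b :=
    if h : ∃ t : Fin i, pos t (fun s => x (s.castLE t.2.le)) = (a, b) then x h.choose else 0

theorem card_ofPositions (pos : (i : ℕ) → (Fin i → 𝕜) → Fin N × Fin N) (len : ℕ)
    (f : Metric.closedBall (0 : LSpace 1 N (LSpace ∞ N 𝕜)) 1) :
    (ofPositions pos len).card f = len := by
  apply le_antisymm
  · exact (ofPositions pos len).card_le (by simp [ofPositions])
  · refine le_iInf₂ fun i hi => ?_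
    have : i = len := by simpa [ofPositions] using hi
    rw [this]

theorem DetAlgorithm.values_castLE {F G K : Type*} {P : Problem F G K} (A : DetAlgorithm P) (f : F)
    {t i : ℕ} (h : t ≤ i) : (fun s => A.values f i (Fin.castLE h s)) = A.values f t := by
  funext s
  rw [A.values_apply, A.values_apply]
  rfl

open Classical in
theorem eval_ofPositions (pos : (i : ℕ) → (Fin i → 𝕜) → Fin N × Fin N) (len : ℕ)
    (f : Metric.closedBall (0 : LSpace 1 N (LSpace ∞ N 𝕜)) 1) (a b : Fin N) :
    (ofPositions pos len).eval f a b =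
      if ∃ t < len, pos t ((ofPositions pos len).values f t) = (a, b) then f.1 a b else 0 := by
  set A := ofPositions pos len with hA
  have key : ∀ i, A.output i (A.values f i) a b =
      if ∃ t < i, pos t (A.values f t) = (a, b) then f.1 a b else 0 := by
    intro i
    by_cases h : ∃ t : Fin i, pos t (fun s => A.values f i (s.castLE t.2.le)) = (a, b)
    · have h1 : A.output i (A.values f i) a b = A.values f i h.choose := dif_pos h
      have h2 := h.choose_spec
      rw [A.values_castLE] at h2
      rw [h1, A.values_apply, if_pos ⟨h.choose, h.choose.2, h2⟩]
      change f.1 (pos _ _).1 (pos _ _).2 = _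
      rw [h2]
    · have h1 : A.output i (A.values f i) a b = 0 := dif_neg h
      rw [h1, if_neg]
      rintro ⟨t, ht, htp⟩
      refine h ⟨⟨t, ht⟩, ?_⟩
      rw [A.values_castLE]
      exact htp
  unfold DetAlgorithm.eval
  rw [card_ofPositions]
  exact key _

/-- Read the positions `q` first, and then those on the list `L` computed from the values at `q`. -/
def twoPhase {M : ℕ} (q : Fin M → Fin N × Fin N) (L : (Fin M → 𝕜) → List (Fin N × Fin N))
    (i : ℕ) (x : Fin i → 𝕜) : Fin N × Fin N :=
  if h : i < M then q ⟨i, h⟩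
  -- Once the list is exhausted, position `(0, 0)` pads the run to its fixed length.
  else (L fun s => x (s.castLE (not_lt.1 h))).getD (i - M) (⟨0, N.pos⟩, ⟨0, N.pos⟩)

theorem values_twoPhase {M : ℕ} (q : Fin M → Fin N × Fin N)
    (L : (Fin M → 𝕜) → List (Fin N × Fin N)) (len : ℕ)
    (f : Metric.closedBall (0 : LSpace 1 N (LSpace ∞ N 𝕜)) 1) :
    (ofPositions (twoPhase q L) len).values f M = fun s => f.1 (q s).1 (q s).2 := by
  funext s
  rw [DetAlgorithm.values_apply]
  change f.1 (twoPhase q L _ _).1 (twoPhase q L _ _).2 = _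
  simp [twoPhase]

theorem eval_twoPhase_of_mem {M : ℕ} (q : Fin M → Fin N × Fin N)
    (L : (Fin M → 𝕜) → List (Fin N × Fin N)) (len : ℕ)
    (f : Metric.closedBall (0 : LSpace 1 N (LSpace ∞ N 𝕜)) 1)
    (hlen : M + (L fun s => f.1 (q s).1 (q s).2).length ≤ len) {a b : Fin N}
    (hab : (a, b) ∈ L fun s => f.1 (q s).1 (q s).2) :
    (ofPositions (twoPhase q L) len).eval f a b = f.1 a b := by
  classical
  rw [eval_ofPositions, if_pos]
  obtain ⟨m, hm, hget⟩ := List.mem_iff_getElem.1 hab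
  refine ⟨M + m, by omega, ?_⟩
  have h : ¬ M + m < M := by omega
  rw [twoPhase, dif_neg h, DetAlgorithm.values_castLE, values_twoPhase]
  simp [hm, hget]

/-- Each entry is either recovered exactly or replaced by `0`, so even a missed row costs no more
than its own norm. -/
theorem norm_sub_eval_le (pos : (i : ℕ) → (Fin i → 𝕜) → Fin N × Fin N) (len : ℕ)
    (f : Metric.closedBall (0 : LSpace 1 N (LSpace ∞ N 𝕜)) 1) (a b : Fin N) :
    ‖f.1 a b - (ofPositions pos len).eval f a b‖ ≤ ‖f.1 a b‖ := by
  rw [eval_ofPositions]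
  split_ifs <;> simp

open Classical in
/-- The positions in all rows in which a value of modulus above `T` was sampled. -/
def flaggedList (𝕜 : Type v) [RCLike 𝕜] (N : ℕ+) (k : ℕ) (T : ℝ) (x : Fin (N * k) → 𝕜) :
    List (Fin N × Fin N) :=
  (({i | ∃ l : Fin k, T < ‖x (finProdFinEquiv (i, l))‖} : Finset (Fin N)) ×ˢ Finset.univ).toList

/-- Sample the columns `J` in all rows, and then read the flagged rows. -/
def screening (𝕜 : Type v) [RCLike 𝕜] {N : ℕ+} {k : ℕ} (T : ℝ) (J : Fin k → Fin N) (len : ℕ) :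
    DetAlgorithm (vectorApprox 𝕜 1 ∞ ∞ 1 N N) :=
  ofPositions (twoPhase
    (fun s : Fin (N * k) => ((finProdFinEquiv.symm s).1, J (finProdFinEquiv.symm s).2))
    (flaggedList 𝕜 N k T)) len

theorem card_large_rows_mul_le (f : Metric.closedBall (0 : LSpace 1 N (LSpace ∞ N 𝕜)) 1)
    {T : ℝ} (s : Finset (Fin N)) (hs : ∀ i ∈ s, T ≤ ‖f.1 i‖) : s.card * T ≤ (N : ℕ) := by
  calc s.card * T = ∑ _i ∈ s, T := by simp
    _ ≤ ∑ i ∈ s, ‖f.1 i‖ := Finset.sum_le_sum hs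
    _ ≤ ∑ i, ‖f.1 i‖ :=
      Finset.sum_le_sum_of_subset_of_nonneg (Finset.subset_univ _) fun i _ _ => norm_nonneg _
    _ ≤ (N : ℕ) := sum_norm_row_le f

/-- `hlen` is the budget multiplied by `T`: `N k` samples, and at most `N / T` flagged rows of `N`
entries each. -/
theorem screening_eval_of_lt {k : ℕ} {T : ℝ} (J : Fin k → Fin N) {len : ℕ}
    (hlen : (N : ℕ) * k * T + (N : ℕ) * (N : ℕ) ≤ len * T) (hT : 0 < T)
    (f : Metric.closedBall (0 : LSpace 1 N (LSpace ∞ N 𝕜)) 1) {i : Fin N}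
    (hi : ∃ l, T < ‖f.1 i (J l)‖) (j : Fin N) : (screening 𝕜 T J len).eval f i j = f.1 i j := by
  classical
  apply eval_twoPhase_of_mem
  · simp only [flaggedList, Finset.length_toList, Finset.card_product, Finset.card_univ,
      Fintype.card_fin, Equiv.symm_apply_apply]
    have hR := card_large_rows_mul_le f
      ({i | ∃ l : Fin k, T < ‖f.1 i (J l)‖} : Finset (Fin N)) (T := T) (by
        intro i hi
        obtain ⟨l, hl⟩ := (Finset.mem_filter.1 hi).2
        exact hl.le.trans (LSpace.norm_apply_le (f.1 i) (J l)))
    set R := ({i | ∃ l : Fin k, T < ‖f.1 i (J l)‖} : Finset (Fin N))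
    have h1 : (R.card : ℝ) * T * (N : ℕ) ≤ (N : ℕ) * (N : ℕ) := by gcongr
    have h2 : (((N : ℕ) * k + R.card * (N : ℕ) : ℕ) : ℝ) * T ≤ len * T := by
      push_cast
      linarith
    exact_mod_cast le_of_mul_le_mul_right h2 hT
  · simpa [flaggedList] using hi

/-- A nonnegative sequence bounded by `m` whose mean `a` exceeds `2 T` has no entry above `T` among
`k` random ones with probability at most `2 m / (k a)`. -/
theorem mean_mul_pow_le {n k : ℕ} (hn : 0 < n) (hk : 0 < k) (x : Fin n → ℝ) {m T a : ℝ}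
    (hT : 0 ≤ T) (hm : 0 ≤ m) (hx : ∀ j, x j ≤ m) (ha : n * a = ∑ j, x j) (haT : 2 * T < a) :
    a * ((Finset.univ.filter fun j => x j ≤ T).card / n : ℝ) ^ k ≤ 2 * m / k := by
  have hn' : (0 : ℝ) < n := by exact_mod_cast hn
  have hk' : (0 : ℝ) < k := by exact_mod_cast hk
  set s := Finset.univ.filter fun j => x j ≤ T
  set p : ℝ := s.card / n with hp
  have hs : (s.card : ℝ) ≤ n := by
    exact_mod_cast (Finset.card_le_univ s).trans (by simp)
  have hp0 : 0 ≤ p := by positivity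
  have hp1 : p ≤ 1 := (div_le_one hn').2 hs
  have hsum : ∑ j, x j ≤ s.card * T + (n - s.card) * m := by
    have h : ∀ j, x j ≤ (if j ∈ s then T - m else 0) + m := by
      intro j
      split_ifs with h
      · simpa using (Finset.mem_filter.1 h).2
      · simpa using hx j
    refine (Finset.sum_le_sum fun j _ => h j).trans (le_of_eq ?_)
    rw [Finset.sum_add_distrib]
    simp
    ring
  have hsn : (s.card : ℝ) = n * p := by rw [hp]; field_simp
  clear_value p
  have hap : a ≤ T + (1 - p) * m := by
    have h1 : n * a ≤ n * (p * T + (1 - p) * m) := by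
      rw [ha]; refine hsum.trans (le_of_eq ?_); rw [hsn]; ring
    have h2 := le_of_mul_le_mul_left h1 hn'
    nlinarith
  -- As `T < a / 2`, the term `T` is absorbed into the left side.
  have ha2 : a ≤ 2 * ((1 - p) * m) := by linarith
  -- Bernoulli bounds `1 + k (1 - p)` by `(2 - p) ^ k`, and `p (2 - p) = 1 - (1 - p)² ≤ 1`.
  have hbern : p ^ k * (k * (1 - p)) ≤ 1 := by
    have h1 : 1 + (k : ℝ) * (1 - p) ≤ (1 + (1 - p)) ^ k :=
      one_add_mul_le_pow (by linarith) k
    have h2 : p ^ k * (1 + (1 - p)) ^ k ≤ 1 := by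
      rw [← mul_pow]
      exact pow_le_one₀ (mul_nonneg hp0 (by linarith)) (by nlinarith [sq_nonneg (1 - p)])
    have h3 : 0 ≤ p ^ k := by positivity
    nlinarith
  rw [le_div_iff₀ hk']
  have h3 : 0 ≤ p ^ k * k := by positivity
  calc a * p ^ k * k = a * (p ^ k * k) := by ring
    _ ≤ 2 * ((1 - p) * m) * (p ^ k * k) := by gcongr
    _ = 2 * m * (p ^ k * (k * (1 - p))) := by ring
    _ ≤ 2 * m * 1 := by gcongr
    _ = 2 * m := by ring

-- Flagged rows have no error, and rows of mean at most `2 T` are harmless. For the rest the maximum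
-- over rows is replaced by a sum, whose expectation can be taken termwise.
open Classical in
theorem norm_sub_screening_le {k : ℕ} {T : ℝ} (J : Fin k → Fin N) {len : ℕ}
    (hlen : (N : ℕ) * k * T + (N : ℕ) * (N : ℕ) ≤ len * T) (hT : 0 < T)
    (f : Metric.closedBall (0 : LSpace 1 N (LSpace ∞ N 𝕜)) 1) :
    ‖(vectorApprox 𝕜 1 ∞ ∞ 1 N N).sol f - (screening 𝕜 T J len).eval f‖ ≤
      2 * T + ∑ i, if 2 * T < ‖(vectorApprox 𝕜 1 ∞ ∞ 1 N N).sol f i‖ ∧ ∀ l, ‖f.1 i (J l)‖ ≤ T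
        then ‖(vectorApprox 𝕜 1 ∞ ∞ 1 N N).sol f i‖ else 0 := by
  set S := (vectorApprox 𝕜 1 ∞ ∞ 1 N N).sol f with hS
  have hterm : ∀ i, 0 ≤ if 2 * T < ‖S i‖ ∧ ∀ l, ‖f.1 i (J l)‖ ≤ T then ‖S i‖ else 0 := by
    intro i; split_ifs <;> simp
  have hsum := Finset.sum_nonneg fun i (_ : i ∈ Finset.univ) => hterm i
  have hbound := add_nonneg (mul_nonneg zero_le_two hT.le) hsum
  refine LSpace.norm_top_le _ hbound fun i => ?_
  have hN : (0 : ℝ) < (N : ℕ) := by exact_mod_cast N.pos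
  have hle : ‖(S - (screening 𝕜 T J len).eval f) i‖ ≤ ‖S i‖ := by
    refine le_of_mul_le_mul_left ?_ hN
    rw [LSpace.card_mul_norm N.pos, LSpace.card_mul_norm N.pos]
    exact Finset.sum_le_sum fun j _ => norm_sub_eval_le _ _ f i j
  by_cases hi : ∀ l, ‖f.1 i (J l)‖ ≤ T
  · rcases le_or_gt ‖S i‖ (2 * T) with h | h
    · linarith
    · have h1 := Finset.single_le_sum (fun i _ => hterm i) (Finset.mem_univ i)
      rw [if_pos ⟨h, hi⟩] at h1
      linarith
  · push Not at hi
    have h0 : (S - (screening 𝕜 T J len).eval f) i = 0 := by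
      funext j
      change f.1 i j - (screening 𝕜 T J len).eval f i j = 0
      rw [screening_eval_of_lt J hlen hT f hi, sub_self]
    rw [h0, norm_zero]
    exact hbound

/-! ### Screening at random columns and its expected error. -/

/-- The distribution of `k` independent uniformly distributed elements of `Fin N`. -/
def sampleMeasure (N : ℕ+) (k : ℕ) : Measure (Fin k → ULift.{u} (Fin N)) :=
  have : Nonempty (ULift.{u} (Fin N)) := ⟨⟨⟨0, N.pos⟩⟩⟩
  Measure.pi fun _ => (PMF.uniformOfFintype (ULift.{u} (Fin N))).toMeasure

instance (k : ℕ) : IsProbabilityMeasure (sampleMeasure.{u} N k) := by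
  unfold sampleMeasure
  infer_instance

theorem sampleMeasure_forall (k : ℕ) (s : Finset (Fin N)) :
    sampleMeasure.{u} N k {J | ∀ l, (J l).down ∈ s} =
      ENNReal.ofReal ((s.card / (N : ℕ) : ℝ) ^ k) := by
  classical
  have : Nonempty (ULift.{u} (Fin N)) := ⟨⟨⟨0, N.pos⟩⟩⟩
  have hset : {J : Fin k → ULift.{u} (Fin N) | ∀ l, (J l).down ∈ s} =
      Set.univ.pi fun _ => {j | j.down ∈ s} := by
    ext J; simp
  have hcard : Fintype.card {j : ULift.{u} (Fin N) | j.down ∈ s} = s.card := by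
    rw [← Fintype.card_coe s]
    exact Fintype.card_congr (Equiv.ulift.subtypeEquiv fun j => Iff.rfl)
  rw [hset, sampleMeasure, Measure.pi_pi]
  simp only [PMF.toMeasure_uniformOfFintype_apply _ (Set.toFinite _).measurableSet, hcard,
    Fintype.card_ulift, Fintype.card_fin, Finset.prod_const, Finset.card_univ]
  rw [ENNReal.ofReal_pow (by positivity), ENNReal.ofReal_div_of_pos (by exact_mod_cast N.pos),
    ENNReal.ofReal_natCast, ENNReal.ofReal_natCast]

/-- The randomized algorithm that screens the rows at `k` random columns. -/
def randScreening (𝕜 : Type v) [RCLike 𝕜] (N : ℕ+) (k : ℕ) (T : ℝ) (len : ℕ) :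
    RandAlgorithm.{u} (vectorApprox 𝕜 1 ∞ ∞ 1 N N) where
  Ω := Fin k → ULift.{u} (Fin N)
  mΩ := inferInstance
  μ := sampleMeasure N k
  isProb := inferInstance
  alg J := screening 𝕜 T (fun l => (J l).down) len

theorem randScreening_cardLE (k : ℕ) (T : ℝ) (len : ℕ) :
    (randScreening.{u} 𝕜 N k T len).CardLE len := by
  intro f
  have hcard : ∀ J, ((randScreening.{u} 𝕜 N k T len).alg J).card f = len :=
    fun J => card_ofPositions _ _ f
  refine ⟨?_, ?_, ?_, ?_⟩
  · simp only [hcard]; exact measurable_const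
  · simp only [hcard, lintegral_const, ENat.toENNReal_coe]
    have := (randScreening.{u} 𝕜 N k T len).isProb
    simp
  · exact @Measurable.of_discrete (Fin k → ULift.{u} (Fin N)) _ _ (borel _) _ _
  · have : Finite (randScreening.{u} 𝕜 N k T len).Ω :=
      inferInstanceAs (Finite (Fin k → ULift.{u} (Fin N)))
    exact ⟨Set.range fun J => ((randScreening.{u} 𝕜 N k T len).alg J).eval f,
      (Set.finite_range _).isSeparable, Filter.Eventually.of_forall fun J => ⟨J, rfl⟩⟩

theorem mean_mul_sampleMeasure_le {k : ℕ} (hk : 0 < k) {T : ℝ} (hT : 0 < T)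
    (f : Metric.closedBall (0 : LSpace 1 N (LSpace ∞ N 𝕜)) 1) (i : Fin N)
    (hi : 2 * T < ‖(vectorApprox 𝕜 1 ∞ ∞ 1 N N).sol f i‖) :
    ENNReal.ofReal ‖(vectorApprox 𝕜 1 ∞ ∞ 1 N N).sol f i‖ *
      sampleMeasure.{u} N k {J | ∀ l, ‖f.1 i (J l).down‖ ≤ T} ≤
      ENNReal.ofReal (2 * ‖f.1 i‖ / k) := by
  have h := sampleMeasure_forall.{u} (N := N) k (Finset.univ.filter fun j => ‖f.1 i j‖ ≤ T)
  simp only [Finset.mem_filter, Finset.mem_univ, true_and] at h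
  rw [h, ← ENNReal.ofReal_mul (norm_nonneg _)]
  exact ENNReal.ofReal_le_ofReal (mean_mul_pow_le N.pos hk (fun j => ‖f.1 i j‖) hT.le
    (norm_nonneg _) (fun j => LSpace.norm_apply_le (f.1 i) j)
    (LSpace.card_mul_norm N.pos ((vectorApprox 𝕜 1 ∞ ∞ 1 N N).sol f i)) hi)

theorem ranError_le_of_screening {k : ℕ} (hk : 0 < k) {T : ℝ} (hT : 0 < T) {n : ℕ}
    (hn : (N : ℕ) * k * T + (N : ℕ) * (N : ℕ) ≤ n * T) :
    ranError.{u} n (vectorApprox 𝕜 1 ∞ ∞ 1 N N) ≤ ENNReal.ofReal (2 * T + 2 * (N : ℕ) / k) := by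
  classical
  refine (iInf₂_le (randScreening 𝕜 N k T n) (randScreening_cardLE k T n)).trans ?_
  refine iSup_le fun f => ?_
  set S := (vectorApprox 𝕜 1 ∞ ∞ 1 N N).sol f with hS
  let E : Fin N → Set (Fin k → ULift.{u} (Fin N)) := fun i => {J | ∀ l, ‖f.1 i (J l).down‖ ≤ T}
  let c : Fin N → ℝ≥0∞ := fun i => if 2 * T < ‖S i‖ then ENNReal.ofReal ‖S i‖ else 0
  have hpt : ∀ J : Fin k → ULift.{u} (Fin N),
      ‖S - (screening 𝕜 T (fun l => (J l).down) n).eval f‖ₑ ≤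
        ENNReal.ofReal (2 * T) + ∑ i, (E i).indicator (fun _ => c i) J := by
    intro J
    rw [← ofReal_norm]
    refine (ENNReal.ofReal_le_ofReal (norm_sub_screening_le _ hn hT f)).trans ?_
    refine ENNReal.ofReal_add_le.trans ?_
    gcongr
    refine (ENNReal.ofReal_sum_of_nonneg fun i _ => by split_ifs <;> simp).trans_le ?_
    refine Finset.sum_le_sum fun i _ => ?_
    by_cases h1 : 2 * T < ‖S i‖ <;> by_cases h2 : ∀ l, ‖f.1 i (J l).down‖ ≤ T <;>
      simp [E, c, Set.indicator, ← hS, h1, h2]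
  refine (lintegral_mono (μ := sampleMeasure.{u} N k) hpt).trans ?_
  rw [lintegral_add_left measurable_const,
    lintegral_finsetSum _ fun i _ => Measurable.of_discrete, lintegral_const, measure_univ, mul_one]
  have hterm : ∀ i, ∫⁻ J, (E i).indicator (fun _ => c i) J ∂sampleMeasure.{u} N k ≤
      ENNReal.ofReal (2 * ‖f.1 i‖ / k) := by
    intro i
    rw [lintegral_indicator_const (Set.toFinite _).measurableSet]
    by_cases h : 2 * T < ‖S i‖
    · simp only [c, if_pos h]
      exact mean_mul_sampleMeasure_le hk hT f i h
    · simp [c, if_neg h]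
  refine (add_le_add_right (Finset.sum_le_sum fun i _ => hterm i) _).trans ?_
  rw [← ENNReal.ofReal_sum_of_nonneg fun i _ => by positivity,
    ← ENNReal.ofReal_add (by positivity) (Finset.sum_nonneg fun i _ => by positivity)]
  refine ENNReal.ofReal_le_ofReal ?_
  rw [← Finset.sum_div, ← Finset.mul_sum]
  gcongr
  exact sum_norm_row_le f

theorem ranNonError_le (n : ℕ) :
    ranNonError.{u} n (vectorApprox 𝕜 1 ∞ ∞ 1 N N) ≤ (N : ℕ) :=
  ranNonError_le_of_norm_le n _ enorm_sol_le

theorem ranError_le_const {n : ℕ} (hn : 1 ≤ n) (hN : ((N : ℕ) : ℝ) ≤ 3 * √n) :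
    ranError.{u} n (vectorApprox 𝕜 1 ∞ ∞ 1 N N) ≤ 108 := by
  have hN0 : (0 : ℝ) < (N : ℕ) := by exact_mod_cast N.pos
  have hsq : ((N : ℕ) : ℝ) * (N : ℕ) ≤ 9 * n := by
    have := mul_le_mul hN hN hN0.le (by positivity)
    nlinarith [Real.mul_self_sqrt (Nat.cast_nonneg (α := ℝ) n)]
  rcases lt_or_ge n 36 with h | h
  -- For small `n` the zero algorithm suffices, since `N² ≤ 9 n < 324`.
  · refine (ranError_le_ranNonError n _).trans ((ranNonError_le n).trans ?_)
    have h1 : (n : ℝ) < 36 := by exact_mod_cast h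
    have : ((N : ℕ) : ℝ) ≤ (108 : ℕ) := by push_cast; nlinarith
    exact_mod_cast this
  · have h36 : (36 : ℝ) ≤ n := by exact_mod_cast h
    have h6 : (6 : ℝ) ≤ √n := Real.le_sqrt_of_sq_le (by linarith)
    have h2N : 2 * ((N : ℕ) : ℝ) ≤ n := by
      nlinarith [Real.mul_self_sqrt (Nat.cast_nonneg (α := ℝ) n)]
    have h2N' : 2 * (N : ℕ) ≤ n := by exact_mod_cast h2N
    -- Half of the budget goes to the samples. With `T = 18` the flagged rows cost at most `N² / 18
    -- ≤ n / 2`, the other half.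
    set k := n / (2 * (N : ℕ)) with hk
    have hk0 : 0 < k := Nat.div_pos h2N' (by have := N.pos; omega)
    have hk1 : (2 * (N : ℕ) : ℝ) * k ≤ n := by exact_mod_cast Nat.mul_div_le n (2 * (N : ℕ))
    have hk2 : (n : ℝ) ≤ 4 * (N : ℕ) * k := by
      have h1 : n < 2 * (N : ℕ) * (k + 1) := by
        have := Nat.lt_mul_div_succ n (show 0 < 2 * (N : ℕ) by have := N.pos; omega)
        exact this
      have h2 : (n : ℝ) < 2 * (N : ℕ) * (k + 1) := by exact_mod_cast h1
      have h3 : (1 : ℝ) ≤ k := by exact_mod_cast hk0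
      nlinarith
    have hk' : (0 : ℝ) < k := by exact_mod_cast hk0
    refine (ranError_le_of_screening (T := 18) hk0 (by norm_num) (by nlinarith)).trans ?_
    refine ENNReal.ofReal_le_of_le_toReal ?_
    -- From `N² ≤ 9 n ≤ 36 N k`; the total is `2 * 18 + 72 = 108`.
    have : 2 * ((N : ℕ) : ℝ) / k ≤ 72 := by
      rw [div_le_iff₀ hk']
      have h1 : ((N : ℕ) : ℝ) * (N : ℕ) ≤ (N : ℕ) * (36 * k) := by nlinarith
      have h2 := le_of_mul_le_mul_left h1 hN0
      linarith
    norm_num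
    linarith

end UpperBounds

end

end IBC

/-! ### Choice of constants and conclusion. -/

theorem corollary1 (𝕜 : Type v) [RCLike 𝕜] :
    ∃ c₀ c₁ c₂ : ℝ, 0 < c₀ ∧ c₀ < 1 ∧ 0 < c₁ ∧ 0 < c₂ ∧
      ∀ n : ℕ, 1 ≤ n → ∃ N₁ N₂ : ℕ+, N₁ = N₂ ∧
        (N₁ : ℕ) = ⌊c₀ ^ (-(1 / 2) : ℝ) * (n : ℝ) ^ (1 / 2 : ℝ)⌋₊ + 1 ∧
        0 < IBC.ranError.{u} n (IBC.vectorApprox 𝕜 1 ∞ ∞ 1 N₁ N₂) ∧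
        IBC.ranError.{u} n (IBC.vectorApprox 𝕜 1 ∞ ∞ 1 N₁ N₂) < ∞ ∧
        IBC.ranNonError.{u} n (IBC.vectorApprox 𝕜 1 ∞ ∞ 1 N₁ N₂) < ∞ ∧
        c₁ * (n : ℝ) ^ (1 / 2 : ℝ) * (Real.logb 2 ((n : ℝ) + 1))⁻¹ ≤
          (IBC.ranNonError.{u} n (IBC.vectorApprox 𝕜 1 ∞ ∞ 1 N₁ N₂)).toReal /
            (IBC.ranError.{u} n (IBC.vectorApprox 𝕜 1 ∞ ∞ 1 N₁ N₂)).toReal ∧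
        (IBC.ranNonError.{u} n (IBC.vectorApprox 𝕜 1 ∞ ∞ 1 N₁ N₂)).toReal /
            (IBC.ranError.{u} n (IBC.vectorApprox 𝕜 1 ∞ ∞ 1 N₁ N₂)).toReal ≤
          c₂ * (n : ℝ) ^ (1 / 2 : ℝ) := by
  -- `c₀ = 1/4` gives `2√n < N ≤ 3√n`. The adaptive error lies in `[3/4, 108]` and the non-adaptive
  -- one in `[3N/4, N]`, so the quotient is at least `(3/4) * 2√n / 108 = √n / 72` and at most `3√n
  -- / (3/4) = 4√n`.
  refine ⟨1 / 4, 1 / 72, 4, by norm_num, by norm_num, by norm_num, by norm_num, fun n hn => ?_⟩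
  let N : ℕ+ := ⟨⌊(1 / 4 : ℝ) ^ (-(1 / 2) : ℝ) * (n : ℝ) ^ (1 / 2 : ℝ)⌋₊ + 1, Nat.succ_pos _⟩
  refine ⟨N, N, rfl, rfl, ?_⟩
  have hquarter : (1 / 4 : ℝ) ^ (-(1 / 2) : ℝ) = 2 := by
    rw [show (1 / 4 : ℝ) = 2 ^ (-2 : ℝ) by norm_num [Real.rpow_neg],
      ← Real.rpow_mul (by norm_num)]
    norm_num
  have hNdef : (N : ℕ) = ⌊2 * √(n : ℝ)⌋₊ + 1 := by
    rw [Real.sqrt_eq_rpow]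
    change ⌊_⌋₊ + 1 = _
    rw [hquarter]
  rw [← Real.sqrt_eq_rpow]
  have hn1 : (1 : ℝ) ≤ n := by exact_mod_cast hn
  have hs1 : 1 ≤ √(n : ℝ) := Real.one_le_sqrt.2 hn1
  have hss : √(n : ℝ) * √(n : ℝ) = n := Real.mul_self_sqrt (by positivity)
  clear_value N
  have hlow : 2 * √(n : ℝ) < (N : ℕ) := by
    rw [hNdef]
    push_cast
    exact Nat.lt_floor_add_one _
  have hup : ((N : ℕ) : ℝ) ≤ 3 * √n := by
    rw [hNdef]
    push_cast
    have := Nat.floor_le (show 0 ≤ 2 * √(n : ℝ) by positivity)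
    linarith
  have hran := IBC.ranError_le_const.{u} (𝕜 := 𝕜) hn hup
  have hnon := IBC.ranNonError_le.{u} (𝕜 := 𝕜) (N := N) n
  have hranGe := IBC.sq_le_ranError.{u} (𝕜 := 𝕜) (N := N) n
  have hnonGe := IBC.sq_le_ranNonError.{u} (𝕜 := 𝕜) (N := N) n
  have hranTop := hran.trans_lt (show (108 : ℝ≥0∞) < ∞ by simp)
  have hnonTop := hnon.trans_lt (ENNReal.natCast_lt_top _)
  generalize IBC.ranError.{u} n (IBC.vectorApprox 𝕜 1 ∞ ∞ 1 N N) = x at *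
  generalize IBC.ranNonError.{u} n (IBC.vectorApprox 𝕜 1 ∞ ∞ 1 N N) = y at *
  lift x to NNReal using hranTop.ne
  lift y to NNReal using hnonTop.ne
  norm_cast at hran hnon hranGe hnonGe
  rw [← NNReal.coe_le_coe] at hran hnon hranGe hnonGe
  push_cast at hran hnon hranGe hnonGe
  have hN0 : (0 : ℝ) < (N : ℕ) := by exact_mod_cast N.pos
  have hN4 : (4 * n : ℝ) ≤ (N : ℕ) * (N : ℕ) := by nlinarith
  have hx : (3 / 4 : ℝ) ≤ x := by
    have : ((N : ℕ) * (N : ℕ) : ℝ) * (3 / 4) ≤ (N : ℕ) * (N : ℕ) * x := by linarith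
    exact le_of_mul_le_mul_left this (by positivity)
  have hy : (3 / 4 : ℝ) * (N : ℕ) ≤ y := by
    have : ((N : ℕ) : ℝ) * (3 / 4 * (N : ℕ)) ≤ (N : ℕ) * y := by linarith
    exact le_of_mul_le_mul_left this (by positivity)
  have hx0 : (0 : ℝ) < x := by linarith
  refine ⟨by exact_mod_cast hx0, hranTop, hnonTop, ?_, ?_⟩
  -- The logarithm is at least `1` because `n + 1 ≥ 2`, so its inverse can be dropped.
  · have hlog : (Real.logb 2 ((n : ℝ) + 1))⁻¹ ≤ 1 := by
      apply inv_le_one_of_one_le₀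
      rw [Real.le_logb_iff_rpow_le (by norm_num) (by positivity), Real.rpow_one]
      linarith
    rw [ENNReal.coe_toReal, ENNReal.coe_toReal, le_div_iff₀ hx0]
    have h1 : 1 / 72 * √(n : ℝ) * (Real.logb 2 ((n : ℝ) + 1))⁻¹ ≤ 1 / 72 * √(n : ℝ) :=
      mul_le_of_le_one_right (by positivity) hlog
    have h2 : 1 / 72 * √(n : ℝ) * x ≤ 1 / 72 * √(n : ℝ) * 108 := by gcongr
    have h3 := mul_le_mul_of_nonneg_right h1 hx0.le
    linarith
  · rw [ENNReal.coe_toReal, ENNReal.coe_toReal, div_le_iff₀ hx0]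
    nlinarith
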